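/- All graphs are finite and simple. A signed graph $\dot G=(G,\sigma)$ is a graph $G$ with a sign function $\sigma:E(G)\to\{+1,-1\}$; write $e(\dot G)=|E(G)|$. For $U\subseteq V(G)$, switching at $U$ reverses the signs of all edges between $U$ and $V(G)\setminus U$. Two signed graphs are switching equivalent, written $\dot G\sim\dot H$, if some switching of $\dot G$ is isomorphic (as a signed graph) to $\dot H$. A signed graph is balanced if it is switching equivalent to an all-positive one, and unbalanced otherwise. Let $C_l^-$ denote a negative cycle of length $l$, i.e. a cycle of length $l$ whose product of edge signs is $-1$ (unique up to switching equivalence). A signed graph is $C_l^-$-free if it has no subgraph switching equivalent to $C_l^-$. Let $C_3^-\cdot K_{n-2}$ denote the signed graph of order $n$ obtained from a negative triangle $C_3^-$ and an all-positive complete graph $K_{n-2}$ by identifying one vertex of the first with one vertex of the second. **Theorem.** Let $\dot G$ be an unbalanced signed graph of order $n$, and let $k$ be an integer with $3\le k\le n/10-1$. If $\dot G$ is $C_{2k+1}^-$-free, then $$e(\dot G)\le \frac{n(n-1)}{2}-2(n-3),$$ with equality if and only if $\dot G\sim C_3^-\cdot K_{n-2}$. -/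

import Mathlib

/-- A signed graph on the vertex set `V`: a simple graph together with a sign `1` or `-1` on each
of its edges. -/
structure SignedGraph (V : Type*) where
  /-- The underlying simple graph. -/
  graph : SimpleGraph V
  /-- The sign function; `ℤˣ = {1, -1}`. -/
  sign : graph.edgeSet → ℤˣ

namespace SignedGraph

variable {V W : Type*}

/-- The number of edges of a (finite) signed graph. -/
noncomputable def edgeCount (G : SignedGraph V) : ℕ := G.graph.edgeSet.ncard

/-- All edges are positive. -/
def AllPositive (G : SignedGraph V) : Prop := ∀ e, G.sign e = 1

/-- `e` is an edge between `U` and the complement of `U`. -/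
def Crosses (U : Set V) (e : Sym2 V) : Prop := ∃ u ∈ U, ∃ v ∉ U, e = s(u, v)

open Classical in
/-- Switching at `U`: the signs of the edges between `U` and its complement are reversed. -/
noncomputable def switch (G : SignedGraph V) (U : Set V) : SignedGraph V where
  graph := G.graph
  sign e := if Crosses U e.1 then -G.sign e else G.sign e

/-- Isomorphism of signed graphs: an isomorphism of the underlying graphs preserving signs. -/
def Isomorphic (G : SignedGraph V) (H : SignedGraph W) : Prop :=
  ∃ f : G.graph ≃g H.graph, ∀ e : G.graph.edgeSet, H.sign (f.mapEdgeSet e) = G.sign e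

/-- Switching equivalence, with isomorphic signed graphs identified: some switching of `G` is
isomorphic to `H`. -/
def SwitchEquiv (G : SignedGraph V) (H : SignedGraph W) : Prop :=
  ∃ U : Set V, (G.switch U).Isomorphic H

/-- A signed graph is balanced if it is switching equivalent to an all-positive signed graph. -/
def Balanced (G : SignedGraph V) : Prop :=
  ∃ H : SignedGraph V, H.AllPositive ∧ G.SwitchEquiv H

/-- The signed graph carried by a subgraph `S` of the underlying graph of `G`: its vertices and
edges are those of `S`, and the signs are inherited from `G`. -/
def ofSubgraph (G : SignedGraph V) (S : G.graph.Subgraph) : SignedGraph S.verts where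
  graph := S.coe
  sign e := G.sign (S.hom.mapEdgeSet e)

/-- `G` is `H`-free: no subgraph of `G` is switching equivalent to `H`. -/
def Free (G : SignedGraph V) (H : SignedGraph W) : Prop :=
  ∀ S : G.graph.Subgraph, ¬ (G.ofSubgraph S).SwitchEquiv H

open Classical in
/-- The negative cycle of length `l` (for `3 ≤ l`): the cycle `0, 1, …, l - 1` in which exactly the
edge joining `l - 1` to `0` is negative, so that the product of the signs is `-1`. Every cycle of
length `l` whose product of signs is `-1` is switching equivalent to it. -/
noncomputable def negCycle (l : ℕ) : SignedGraph (Fin l) where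
  graph := SimpleGraph.cycleGraph l
  sign e := if ∃ a b : Fin l, a.val = 0 ∧ b.val + 1 = l ∧ e.1 = s(a, b) then -1 else 1

open Classical in
/-- The coalescence of the negative triangle and the all-positive complete graph on `n - 2`
vertices (for `3 ≤ n`), on the vertex set `{0, …, n - 1}`: the vertices `0, 1, 2` form a triangle
whose only negative edge is `{0, 1}`, the vertices `2, …, n - 1` form an all-positive complete
graph, and there are no other edges. -/
noncomputable def negTriangleCoalescence (n : ℕ) : SignedGraph (Fin n) where
  graph :=
    { Adj := fun i j => i ≠ j ∧ ((i.val ≤ 2 ∧ j.val ≤ 2) ∨ (2 ≤ i.val ∧ 2 ≤ j.val))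
      symm := ⟨fun _ _ h => ⟨h.1.symm, h.2.imp And.symm And.symm⟩⟩
      loopless := ⟨fun _ h => h.1 rfl⟩ }
  sign e := if ∃ a b : Fin n, a.val = 0 ∧ b.val = 1 ∧ e.1 = s(a, b) then -1 else 1

end SignedGraph

namespace SignedGraph

open Finset

variable {V W : Type*}

/-! Suppose at least `n(n-1)/2 - 2(n-3)` edges are present, so that at most `2n - 6` pairs are
missing. Turán's theorem then yields a clique `Q` on `2k + 2` vertices. Inside `Q`, the absence of
negative `(2k+1)`-cycles forces the sign of `xy` to be `g x * g y` for some `g : V → ℤˣ`; such a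
potential on all of `V` is the same as balance.

The potential spreads: a vertex outside a set with a potential closes paths of the set into cycles
of length `2k + 1`, so its edges into the set agree on its own value, provided the set has paths of
the right length between any two vertices. Absorbing vertices with two neighbours in the set keeps
this property at the cost of two in the shortest path length; `k ≥ 3` leaves room for two rounds, `Q
⊆ A ⊆ B`.

If at most one vertex lies outside `B`, the graph is balanced. Otherwise two vertices `u, v` outside
`B` each miss all but at most one vertex of `A`, and any other vertex outside `A` misses at least
`2k + 1` vertices of `Q`. The budget `2n - 6` leaves no such other vertex and no missing pair inside
`A`; unbalance then makes `u, v` and a common neighbour a negative triangle. -/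

/-! ### Signs, switching and potentials -/

open Classical in
/-- The sign of the pair `u, v`, with value `1` on pairs that are not adjacent. -/
noncomputable def sgn (G : SignedGraph V) (u v : V) : ℤˣ :=
  if h : G.graph.Adj u v then G.sign ⟨s(u, v), h⟩ else 1

lemma sgn_of_adj (G : SignedGraph V) {u v : V} (h : G.graph.Adj u v) :
    G.sgn u v = G.sign ⟨s(u, v), h⟩ := dif_pos h

lemma sgn_comm (G : SignedGraph V) (u v : V) : G.sgn u v = G.sgn v u := by
  by_cases h : G.graph.Adj u v
  · rw [sgn_of_adj G h, sgn_of_adj G h.symm]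
    congr 1
    exact Subtype.ext Sym2.eq_swap
  · rw [sgn, sgn, dif_neg h, dif_neg (fun h' => h h'.symm)]

lemma crosses_mk (U : Set V) (x y : V) : Crosses U s(x, y) ↔ ¬(x ∈ U ↔ y ∈ U) := by
  constructor
  · rintro ⟨u, hu, v, hv, h⟩
    rcases Sym2.eq_iff.1 h with ⟨rfl, rfl⟩ | ⟨rfl, rfl⟩ <;> tauto
  · intro h
    by_cases hx : x ∈ U
    · exact ⟨x, hx, y, by tauto, rfl⟩
    · exact ⟨y, by tauto, x, hx, Sym2.eq_swap⟩

open Classical in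
/-- Switching at the vertices where the potential `h` is negative multiplies the sign of each
edge by the values of `h` at its ends. -/
lemma switchEquiv_of_potential (G : SignedGraph V) (H : SignedGraph W) (φ : H.graph ≃g G.graph)
    (h : V → ℤˣ) (hh : ∀ x y, H.graph.Adj x y →
      G.sgn (φ x) (φ y) = h (φ x) * h (φ y) * H.sgn x y) : G.SwitchEquiv H := by
  refine ⟨{x | h x = -1}, φ.symm, ?_⟩
  rintro ⟨e, he⟩
  induction e using Sym2.ind with
  | _ x y =>
  have hxy : G.graph.Adj x y := he
  have h2 : H.graph.Adj (φ.symm x) (φ.symm y) := φ.symm.map_adj_iff.2 hxy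
  have h1 := hh _ _ h2
  simp only [RelIso.apply_symm_apply] at h1
  rw [sgn_of_adj _ hxy, sgn_of_adj _ h2] at h1
  change H.sign ⟨s(φ.symm x, φ.symm y), h2⟩ =
    if Crosses {x | h x = -1} s(x, y) then -G.sign ⟨s(x, y), hxy⟩ else G.sign ⟨s(x, y), hxy⟩
  rw [h1, crosses_mk]
  rcases Int.units_eq_one_or (h x) with hx | hx <;> rcases Int.units_eq_one_or (h y) with hy | hy <;>
    simp [hx, hy]

lemma balanced_of_potential (G : SignedGraph V) (h : V → ℤˣ)
    (hh : ∀ x y, G.graph.Adj x y → G.sgn x y = h x * h y) : G.Balanced := by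
  refine ⟨⟨G.graph, fun _ => 1⟩, fun _ => rfl, ?_⟩
  refine switchEquiv_of_potential G _ (SimpleGraph.Iso.refl) h fun x y hxy => ?_
  have : (⟨G.graph, fun _ => 1⟩ : SignedGraph V).sgn x y = 1 := by simp [sgn]
  rw [this, mul_one]
  exact hh x y hxy

lemma edgeCount_eq_of_switchEquiv {G : SignedGraph V} {H : SignedGraph W} (h : G.SwitchEquiv H) :
    G.edgeCount = H.edgeCount := by
  obtain ⟨U, f, -⟩ := h
  exact Nat.card_congr f.mapEdgeSet

/-! ### Signs of walks and closing a path to a cycle -/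

/-- The product of the signs along a walk. -/
noncomputable def walkSign (G : SignedGraph V) : ∀ {a b : V}, G.graph.Walk a b → ℤˣ
  | _, _, .nil => 1
  | _, _, .cons (u := u) (v := v) _ p => G.sgn u v * G.walkSign p

@[simp] lemma walkSign_nil (G : SignedGraph V) (a : V) :
    G.walkSign (SimpleGraph.Walk.nil : G.graph.Walk a a) = 1 := rfl

@[simp] lemma walkSign_cons (G : SignedGraph V) {a b c : V} (h : G.graph.Adj a b)
    (p : G.graph.Walk b c) : G.walkSign (.cons h p) = G.sgn a b * G.walkSign p := rfl

/-- The product telescopes, since each inner vertex contributes a square. -/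
lemma walkSign_eq (G : SignedGraph V) {a b : V} (p : G.graph.Walk a b) (A : Finset V)
    (g : V → ℤˣ) (hg : ∀ x ∈ A, ∀ y ∈ A, G.graph.Adj x y → G.sgn x y = g x * g y)
    (hp : ∀ x ∈ p.support, x ∈ A) : G.walkSign p = g a * g b := by
  induction p with
  | nil => simp [← sq]
  | @cons u v w h p ih =>
    simp only [SimpleGraph.Walk.support_cons, List.mem_cons, forall_eq_or_imp] at hp
    rw [walkSign_cons, ih hp.2, hg u hp.1 v (hp.2 v p.start_mem_support) h]
    calc g u * g v * (g v * g w) = g u * (g v ^ 2) * g w := by rw [sq]; simp only [mul_assoc]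
      _ = _ := by rw [Int.units_sq, mul_one]

/-- Each path carries a potential for the signs of its edges. -/
lemma exists_getVert_potential (G : SignedGraph V) {a b : V} (p : G.graph.Walk a b) :
    ∃ h : ℕ → ℤˣ, (∀ i < p.length, G.sgn (p.getVert i) (p.getVert (i + 1)) = h i * h (i + 1)) ∧
      h 0 * h p.length = G.walkSign p := by
  induction p with
  | nil => exact ⟨fun _ => 1, by simp, by simp⟩
  | @cons u v w hadj p ih =>
    obtain ⟨h, h1, h2⟩ := ih
    refine ⟨fun i => Nat.casesOn i (G.sgn u v * h 0) h, ?_, ?_⟩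
    · intro i hi
      cases i with
      | zero => simp [mul_assoc, ← sq]
      | succ i =>
        simp only [SimpleGraph.Walk.length_cons, add_lt_add_iff_right] at hi
        simpa using h1 i hi
    · rw [walkSign_cons, ← h2]
      exact mul_assoc _ _ _

lemma cycleGraph_adj_cases {l : ℕ} {i j : Fin l} (h : (SimpleGraph.cycleGraph l).Adj i j) :
    (i.val + 1 = j.val ∨ j.val + 1 = i.val) ∨
      (2 < l → (i.val = 0 ∧ j.val + 1 = l) ∨ (j.val = 0 ∧ i.val + 1 = l)) := by
  rw [SimpleGraph.cycleGraph_adj'] at h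
  have hi := i.2
  have hj := j.2
  simp only [Fin.sub_def] at h
  by_cases h2 : i.val ≤ j.val
  · rcases h with h | h
    · by_cases h3 : i.val = j.val
      · simp only [h3] at h
        rw [Nat.sub_add_cancel hj.le, Nat.mod_self] at h
        omega
      · rw [Nat.mod_eq_of_lt (by omega)] at h
        omega
    · rw [show l - i.val + j.val = (j.val - i.val) + l by omega, Nat.add_mod_right,
        Nat.mod_eq_of_lt (by omega)] at h
      omega
  · rcases h with h | h
    · rw [show l - j.val + i.val = (i.val - j.val) + l by omega, Nat.add_mod_right,
        Nat.mod_eq_of_lt (by omega)] at h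
      omega
    · rw [Nat.mod_eq_of_lt (by omega)] at h
      omega

/-- In a `C_{l}^-`-free signed graph, a path with `l` vertices cannot be closed up to a negative
cycle. -/
theorem walkSign_mul_sgn_of_free (G : SignedGraph V) {l : ℕ} (hl : 2 ≤ l)
    (hfree : G.Free (negCycle (l + 1))) {a b : V} (p : G.graph.Walk a b) (hp : p.IsPath)
    (hlen : p.length = l) (hab : G.graph.Adj b a) : G.walkSign p * G.sgn b a = 1 := by
  by_contra hne
  obtain ⟨h, h1, h2⟩ := G.exists_getVert_potential p
  have hinj : Function.Injective (fun i : Fin (l + 1) => p.getVert i.val) := by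
    intro i j hij
    exact Fin.ext (hp.getVert_injOn (by have := i.2; simp; omega)
      (by have := j.2; simp; omega) hij)
  have h0 : p.getVert 0 = a := p.getVert_zero
  have hL : p.getVert l = b := hlen ▸ p.getVert_length
  have hadj : ∀ i j : Fin (l + 1), i.val + 1 = j.val →
      G.graph.Adj (p.getVert i.val) (p.getVert j.val) := by
    intro i j hij
    rw [← hij]
    exact p.adj_getVert_succ (by have := j.2; omega)
  have hadj' : ∀ i j : Fin (l + 1), i.val = 0 → j.val + 1 = l + 1 →
      G.graph.Adj (p.getVert i.val) (p.getVert j.val) := by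
    intro i j hi hj
    rw [hi, h0, show j.val = l by omega, hL]
    exact hab.symm
  let f : (SimpleGraph.cycleGraph (l + 1)) →g G.graph :=
    ⟨fun i => p.getVert i.val, by
      intro i j hij
      rcases cycleGraph_adj_cases hij with (h | h) | h
      · exact hadj _ _ h
      · exact (hadj _ _ h).symm
      · rcases h (by omega) with h | h
        · exact hadj' _ _ h.1 h.2
        · exact (hadj' _ _ h.1 h.2).symm⟩
  let F : SimpleGraph.Copy (SimpleGraph.cycleGraph (l + 1)) G.graph := ⟨f, hinj⟩
  have hS : ∀ x y, F.toSubgraph.coe.Adj x y →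
      (G.ofSubgraph F.toSubgraph).sgn x y = G.sgn x.1 y.1 := by
    intro x y hxy
    rw [sgn_of_adj (G.ofSubgraph F.toSubgraph) hxy, sgn_of_adj G (F.toSubgraph.adj_sub hxy)]
    rfl
  -- The potential is that of the path, read by position along it. It makes every path edge
  -- positive, so the whole sign of the cycle falls on the closing edge, which is where `negCycle`
  -- has its `-1`.
  refine hfree F.toSubgraph (switchEquiv_of_potential _ (negCycle (l + 1)) F.isoToSubgraph
    (fun x => h (F.isoToSubgraph.symm x).val) ?_)
  intro i j hij
  have hij' : (SimpleGraph.cycleGraph (l + 1)).Adj i j := hij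
  refine (hS _ _ (F.isoToSubgraph.map_adj_iff.2 hij')).trans ?_
  have hsymm : ∀ i, F.isoToSubgraph.symm (F.isoToSubgraph i) = i := F.isoToSubgraph.symm_apply_apply
  change G.sgn (p.getVert i.val) (p.getVert j.val) = h (F.isoToSubgraph.symm (F.isoToSubgraph i)).val
    * h (F.isoToSubgraph.symm (F.isoToSubgraph j)).val * (negCycle (l + 1)).sgn i j
  rw [hsymm, hsymm]
  have key1 : ∀ i j : Fin (l + 1), (negCycle (l + 1)).graph.Adj i j → i.val + 1 = j.val →
      G.sgn (p.getVert i.val) (p.getVert j.val) =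
        h i.val * h j.val * (negCycle (l + 1)).sgn i j := by
    intro i j hij e
    have : (negCycle (l + 1)).sgn i j = 1 := by
      rw [sgn_of_adj _ hij]
      change (if _ then _ else _ : ℤˣ) = 1
      rw [if_neg]
      rintro ⟨a, b, ha, hb, hs⟩
      rcases Sym2.eq_iff.1 hs with ⟨rfl, rfl⟩ | ⟨rfl, rfl⟩ <;> omega
    rw [this, mul_one, ← e]
    exact h1 _ (by have := j.2; omega)
  have key2 : ∀ i j : Fin (l + 1), (negCycle (l + 1)).graph.Adj i j →
      i.val = 0 ∧ j.val + 1 = l + 1 → G.sgn (p.getVert i.val) (p.getVert j.val) =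
        h i.val * h j.val * (negCycle (l + 1)).sgn i j := by
    intro i j hij e
    have : (negCycle (l + 1)).sgn i j = -1 := by
      rw [sgn_of_adj _ hij]
      change (if _ then _ else _ : ℤˣ) = -1
      rw [if_pos]
      exact ⟨i, j, e.1, e.2, rfl⟩
    rw [this, e.1, show j.val = l by omega, h0, hL, sgn_comm, ← hlen, h2]
    rcases Int.units_eq_one_or (G.walkSign p) with hx | hx <;>
      rcases Int.units_eq_one_or (G.sgn b a) with hy | hy <;> simp_all
  rcases cycleGraph_adj_cases hij' with (hc | hc) | hc
  · exact key1 _ _ hij hc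
  · rw [sgn_comm, key1 _ _ hij.symm hc, sgn_comm _ j i, mul_comm (h _)]
  · rcases hc (by omega) with hc | hc
    · exact key2 _ _ hij hc
    · rw [sgn_comm, key2 _ _ hij.symm hc, sgn_comm _ j i, mul_comm (h _)]

/-! ### Potentials on sets with paths of prescribed length -/

/-- `g` is a potential for the signs of the edges inside `A`. -/
def IsPotential (G : SignedGraph V) (A : Finset V) (g : V → ℤˣ) : Prop :=
  ∀ x ∈ A, ∀ y ∈ A, G.graph.Adj x y → G.sgn x y = g x * g y

/-- Any two distinct vertices of `A` are joined by a path of length `l` inside `A`. -/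
def PathConnected (G : SignedGraph V) (A : Finset V) (l : ℕ) : Prop :=
  ∀ a ∈ A, ∀ b ∈ A, a ≠ b → ∃ p : G.graph.Walk a b, p.IsPath ∧ p.length = l ∧
    ∀ x ∈ p.support, x ∈ A

lemma units_mul_cancel (a b : ℤˣ) : a * (a * b) = b := by
  rw [← mul_assoc, ← sq, Int.units_sq, one_mul]

lemma units_mul_eq_one (a b : ℤˣ) : a * b = 1 ↔ a = b := by
  rcases Int.units_eq_one_or a with rfl | rfl <;> rcases Int.units_eq_one_or b with rfl | rfl <;> simp

/-- In a clique there are paths of all lengths between any two vertices. -/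
lemma pathConnected_of_isClique (G : SignedGraph V) (l : ℕ) (Q : Finset V)
    (hQ : G.graph.IsClique (Q : Set V)) (h1 : 1 ≤ l) (h2 : l + 1 ≤ #Q) :
    G.PathConnected Q l := by
  classical
  induction l, h1 using Nat.le_induction generalizing Q with
  | base =>
    intro a ha b hb hab
    have hadj : G.graph.Adj a b := hQ ha hb hab
    exact ⟨.cons hadj .nil, by simp [hab], rfl, by simp [ha, hb]⟩
  | succ l hl ih =>
    intro a ha b hb hab
    have hc : 0 < #((Q.erase a).erase b) := by
      rw [card_erase_of_mem (by simp [hb, hab.symm]), card_erase_of_mem ha]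
      omega
    obtain ⟨c, hc⟩ := card_pos.1 hc
    simp only [mem_erase] at hc
    obtain ⟨p, hp, hl, hs⟩ := ih (Q.erase a) (hQ.subset (by simp))
      (by rw [card_erase_of_mem ha]; omega) c (by simp [hc]) b (by simp [hb, hab.symm]) hc.1
    have hadj : G.graph.Adj a c := hQ ha hc.2.2 (Ne.symm hc.2.1)
    refine ⟨.cons hadj p, ?_, by simp [hl], ?_⟩
    · rw [SimpleGraph.Walk.cons_isPath_iff]
      exact ⟨hp, fun h => by simpa using hs a h⟩
    · intro x hx
      rw [SimpleGraph.Walk.support_cons, List.mem_cons] at hx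
      rcases hx with rfl | hx
      · exact ha
      · exact mem_of_mem_erase (hs x hx)

/-- A path of length `m` from `a` to `b` in `A` closes through `v` to a cycle of length `m + 2`,
which must be positive. Hence the value that `v` needs does not depend on the neighbour used to
compute it. -/
lemma sgn_mul_eq_of_pathConnected (G : SignedGraph V) {A : Finset V} {g : V → ℤˣ} {m : ℕ}
    (hm : 1 ≤ m) (hfree : G.Free (negCycle (m + 2))) (hg : G.IsPotential A g)
    (hA : G.PathConnected A m) {v a b : V} (hv : v ∉ A) (ha : a ∈ A) (hb : b ∈ A)
    (hva : G.graph.Adj v a) (hvb : G.graph.Adj v b) : G.sgn v a * g a = G.sgn v b * g b := by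
  by_cases hab : a = b
  · rw [hab]
  obtain ⟨p, hp, hl, hs⟩ := hA a ha b hb hab
  have hpath : (SimpleGraph.Walk.cons hva p).IsPath := by
    rw [SimpleGraph.Walk.cons_isPath_iff]
    exact ⟨hp, fun h => hv (hs v h)⟩
  have := G.walkSign_mul_sgn_of_free (l := m + 1) (by omega) hfree _ hpath (by simp [hl]) hvb.symm
  rw [walkSign_cons, G.walkSign_eq p A g hg hs, sgn_comm _ b v] at this
  rw [← units_mul_eq_one, ← this]
  simp only [mul_assoc, mul_comm, mul_left_comm]

/-- Here the path closes through both `u` and `v`, giving length `m + 3`. The condition `a ≠ b` is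
essential: with a single common neighbour there is only a triangle, and the extremal graph lives in
this gap. -/
lemma sgn_eq_of_pathConnected (G : SignedGraph V) {A : Finset V} {g : V → ℤˣ} {m : ℕ}
    (hfree : G.Free (negCycle (m + 3))) (hg : G.IsPotential A g)
    (hA : G.PathConnected A m) {u v a b : V} (hu : u ∉ A) (hv : v ∉ A) (ha : a ∈ A) (hb : b ∈ A)
    (huv : G.graph.Adj u v) (hua : G.graph.Adj u a) (hvb : G.graph.Adj v b) (hab : a ≠ b) :
    G.sgn u v = (G.sgn u a * g a) * (G.sgn v b * g b) := by
  obtain ⟨p, hp, hl, hs⟩ := hA a ha b hb hab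
  have hpath : (SimpleGraph.Walk.cons huv.symm (.cons hua p)).IsPath := by
    rw [SimpleGraph.Walk.cons_isPath_iff, SimpleGraph.Walk.cons_isPath_iff]
    refine ⟨⟨hp, fun h => hu (hs u h)⟩, fun h => ?_⟩
    rw [SimpleGraph.Walk.support_cons, List.mem_cons] at h
    exact h.elim huv.symm.ne fun h => hv (hs v h)
  have := G.walkSign_mul_sgn_of_free (l := m + 2) (by omega) hfree _ hpath (by simp [hl]) hvb.symm
  rw [walkSign_cons, walkSign_cons, G.walkSign_eq p A g hg hs, sgn_comm _ b v,
    sgn_comm _ v u] at this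
  rw [← units_mul_eq_one, ← this]
  simp only [mul_assoc, mul_comm, mul_left_comm]

/-- A potential on `A` extends to the vertices outside, as far as edges to `A` are concerned. -/
lemma exists_extend_potential (G : SignedGraph V) {A : Finset V} {g : V → ℤˣ} {m : ℕ}
    (hm : 1 ≤ m) (hfree : G.Free (negCycle (m + 2))) (hg : G.IsPotential A g)
    (hA : G.PathConnected A m) : ∃ g' : V → ℤˣ, (∀ x ∈ A, g' x = g x) ∧
      ∀ v ∉ A, ∀ a ∈ A, G.graph.Adj v a → g' v = G.sgn v a * g a := by
  classical
  -- Any chosen neighbour gives the same value; a vertex without neighbours in `A` gets an arbitrary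
  -- one.
  refine ⟨fun v => if v ∈ A then g v else
    if h : ∃ a ∈ A, G.graph.Adj v a then G.sgn v h.choose * g h.choose else 1,
    fun x hx => if_pos hx, fun v hv a ha hva => ?_⟩
  have h : ∃ a ∈ A, G.graph.Adj v a := ⟨a, ha, hva⟩
  simp only [if_neg hv, dif_pos h]
  exact G.sgn_mul_eq_of_pathConnected hm hfree hg hA hv h.choose_spec.1 ha h.choose_spec.2 hva

/-! ### Absorbing vertices with two neighbours -/

section Absorb

variable [Fintype V]

open Classical in
/-- `A` together with all vertices that have at least two neighbours in `A`. -/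
noncomputable def absorb (G : SignedGraph V) (A : Finset V) : Finset V :=
  {v | v ∈ A ∨ 2 ≤ #{a ∈ A | G.graph.Adj v a}}

lemma subset_absorb (G : SignedGraph V) (A : Finset V) : A ⊆ G.absorb A := fun x hx => by
  simp [absorb, hx]

lemma exists_adj_ne_of_mem_absorb (G : SignedGraph V) {A : Finset V} {v : V}
    (hv : v ∈ G.absorb A) (hvA : v ∉ A) (b : V) : ∃ a ∈ A, G.graph.Adj v a ∧ a ≠ b := by
  classical
  have h : 1 < #{a ∈ A | G.graph.Adj v a} := by
    simpa [absorb, hvA, Nat.lt_iff_add_one_le] using hv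
  obtain ⟨a, ha, hab⟩ := exists_mem_ne h b
  simp only [mem_filter] at ha
  exact ⟨a, ha.1, ha.2, hab⟩

lemma eq_of_notMem_absorb (G : SignedGraph V) {A : Finset V} {v a b : V}
    (hv : v ∉ G.absorb A) (ha : a ∈ A) (hb : b ∈ A) (hva : G.graph.Adj v a)
    (hvb : G.graph.Adj v b) : a = b := by
  classical
  by_contra hab
  refine hv ?_
  simp only [absorb, mem_filter, mem_univ, true_and]
  refine Or.inr (one_lt_card.2 ⟨a, by simp [ha, hva], b, by simp [hb, hvb], hab⟩)

/-- Edges into `A` use paths of length `m + 1`, edges between two new vertices use length `m`.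
Having two neighbours in `A` lets the two new vertices attach at distinct points. -/
lemma exists_isPotential_absorb (G : SignedGraph V) {A : Finset V} {g : V → ℤˣ} {m : ℕ}
    (hfree : G.Free (negCycle (m + 3))) (hg : G.IsPotential A g)
    (h0 : G.PathConnected A m) (h1 : G.PathConnected A (m + 1)) :
    ∃ g', G.IsPotential (G.absorb A) g' := by
  obtain ⟨g', hgA, hgv⟩ := G.exists_extend_potential (by omega) hfree hg h1
  have key : ∀ x ∉ A, ∀ y ∈ A, G.graph.Adj x y → G.sgn x y = g' x * g' y := by
    intro x hx y hy hxy
    rw [hgv x hx y hy hxy, hgA y hy, mul_assoc, ← sq, Int.units_sq, mul_one]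
  refine ⟨g', fun x hx y hy hxy => ?_⟩
  by_cases hxA : x ∈ A <;> by_cases hyA : y ∈ A
  · rw [hgA x hxA, hgA y hyA, hg x hxA y hyA hxy]
  · rw [sgn_comm, key y hyA x hxA hxy.symm, mul_comm]
  · exact key x hxA y hyA hxy
  · obtain ⟨a, ha, hxa, -⟩ := G.exists_adj_ne_of_mem_absorb hx hxA x
    obtain ⟨b, hb, hyb, hba⟩ := G.exists_adj_ne_of_mem_absorb hy hyA a
    rw [hgv x hxA a ha hxa, hgv y hyA b hb hyb]
    exact G.sgn_eq_of_pathConnected hfree hg h0 hxA hyA ha hb hxy hxa hyb hba.symm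

/-- Each new endpoint costs one step into `A`, so the part inside `A` has length `l + 2`, `l + 1` or
`l`; the second neighbour keeps its ends distinct. -/
lemma pathConnected_absorb (G : SignedGraph V) {A : Finset V} {l : ℕ}
    (h0 : G.PathConnected A l) (h1 : G.PathConnected A (l + 1))
    (h2 : G.PathConnected A (l + 2)) : G.PathConnected (G.absorb A) (l + 2) := by
  have hsub := G.subset_absorb A
  have one : ∀ a ∈ G.absorb A, a ∉ A → ∀ b ∈ A, ∃ p : G.graph.Walk a b,
      p.IsPath ∧ p.length = l + 2 ∧ ∀ x ∈ p.support, x ∈ G.absorb A := by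
    intro a ha haA b hb
    obtain ⟨c, hc, hac, hcb⟩ := G.exists_adj_ne_of_mem_absorb ha haA b
    obtain ⟨p, hp, hl, hs⟩ := h1 c hc b hb hcb
    refine ⟨.cons hac p, ?_, by simp [hl], ?_⟩
    · rw [SimpleGraph.Walk.cons_isPath_iff]
      exact ⟨hp, fun h => haA (hs a h)⟩
    · rw [SimpleGraph.Walk.support_cons]
      exact List.forall_mem_cons.2 ⟨ha, fun x hx => hsub (hs x hx)⟩
  intro a ha b hb hab
  by_cases haA : a ∈ A <;> by_cases hbA : b ∈ A
  · obtain ⟨p, hp, hl, hs⟩ := h2 a haA b hbA hab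
    exact ⟨p, hp, hl, fun x hx => hsub (hs x hx)⟩
  · obtain ⟨p, hp, hl, hs⟩ := one b hb hbA a haA
    exact ⟨p.reverse, hp.reverse, by simp [hl], by simpa using hs⟩
  · exact one a ha haA b hbA
  · obtain ⟨c, hc, hac, -⟩ := G.exists_adj_ne_of_mem_absorb ha haA a
    obtain ⟨d, hd, hbd, hdc⟩ := G.exists_adj_ne_of_mem_absorb hb hbA c
    obtain ⟨p, hp, hl, hs⟩ := h0 d hd c hc hdc
    have hp1 : (SimpleGraph.Walk.cons hbd p).IsPath := by
      rw [SimpleGraph.Walk.cons_isPath_iff]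
      exact ⟨hp, fun h => hbA (hs b h)⟩
    have hs1 : ∀ x ∈ (SimpleGraph.Walk.cons hbd p).reverse.support, x = b ∨ x ∈ A := by
      intro x hx
      rw [SimpleGraph.Walk.support_reverse, List.mem_reverse, SimpleGraph.Walk.support_cons,
        List.mem_cons] at hx
      exact hx.imp_right (hs x)
    refine ⟨.cons hac (SimpleGraph.Walk.cons hbd p).reverse, ?_, by simp [hl], ?_⟩
    · rw [SimpleGraph.Walk.cons_isPath_iff]
      exact ⟨hp1.reverse, fun h => (hs1 a h).elim hab haA⟩
    · rw [SimpleGraph.Walk.support_cons]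
      exact List.forall_mem_cons.2 ⟨ha, fun x hx => (hs1 x hx).elim (fun h => h ▸ hb)
        fun h => hsub h⟩

end Absorb

/-! ### A potential on a large clique -/

/-- Around a 4-cycle in a clique the product of the signs is `1`. -/
lemma sgn_mul_sgn_eq_of_isClique (G : SignedGraph V) {Q : Finset V} {m : ℕ} (hm : 1 ≤ m)
    (hfree : G.Free (negCycle (m + 2))) (hQ : G.graph.IsClique (Q : Set V)) (hcard : m + 3 ≤ #Q)
    {a b c d : V} (ha : a ∈ Q) (hb : b ∈ Q) (hc : c ∈ Q) (hd : d ∈ Q) (hab : a ≠ b)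
    (hac : a ≠ c) (had : a ≠ d) (hbc : b ≠ c) (hcd : c ≠ d) :
    G.sgn b a * G.sgn b c = G.sgn d a * G.sgn d c := by
  classical
  -- One path from `a` to `c` avoiding `b` and `d` closes through either of them to a positive cycle
  -- of length `m + 2`; comparing the two gives the claim.
  obtain ⟨p, hp, hl, hs⟩ := G.pathConnected_of_isClique m ((Q.erase b).erase d)
    (hQ.subset (by intro x; simp; tauto)) hm
    (by have := pred_card_le_card_erase (s := Q) (a := b)
        have := pred_card_le_card_erase (s := Q.erase b) (a := d)
        omega) a (by simp [*]) c (by simp [hbc.symm, *]) hac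
  have key : ∀ v ∈ Q, v ≠ a → v ≠ c → v ∉ p.support →
      G.sgn v a * G.sgn v c = G.walkSign p := by
    intro v hv hva hvc hvs
    have h1 : G.graph.Adj v a := hQ hv ha hva
    have h2 : G.graph.Adj v c := hQ hv hc hvc
    have hpath : (SimpleGraph.Walk.cons h1 p).IsPath := by
      rw [SimpleGraph.Walk.cons_isPath_iff]
      exact ⟨hp, hvs⟩
    have := G.walkSign_mul_sgn_of_free (l := m + 1) (by omega) hfree _ hpath (by simp [hl]) h2.symm
    rw [walkSign_cons, sgn_comm _ c v] at this
    rw [← units_mul_eq_one, ← this]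
    simp only [mul_assoc, mul_comm, mul_left_comm]
  rw [key b hb hab.symm hbc (fun h => by simpa using hs b h),
    key d hd had.symm hcd.symm (fun h => by simpa using hs d h)]

/-- The signs in a large clique come from a potential up to a global sign. -/
lemma exists_potential_up_to_sign (G : SignedGraph V) {Q : Finset V}
    (hQ : 3 ≤ #Q)
    (h4 : ∀ a ∈ Q, ∀ b ∈ Q, ∀ c ∈ Q, ∀ d ∈ Q, a ≠ b → a ≠ c → a ≠ d → b ≠ c → c ≠ d →
      G.sgn b a * G.sgn b c = G.sgn d a * G.sgn d c) :
    ∃ (s : ℤˣ) (g : V → ℤˣ), ∀ x ∈ Q, ∀ y ∈ Q, x ≠ y → G.sgn x y = s * (g x * g y) := by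
  classical
  obtain ⟨r, hr, u, hu, v, hv, hru, hrv, huv⟩ := two_lt_card.1 hQ
  -- The sign of the triangle on the root `r` and `x, y`. Positive 4-cycles make it constant, and
  -- that constant is the global sign `s`.
  set τ : V → V → ℤˣ := fun x y => G.sgn r x * G.sgn r y * G.sgn x y with hτ
  have hcomm : ∀ x y, τ x y = τ y x := by
    intro x y
    simp only [hτ, G.sgn_comm x y, mul_comm (G.sgn r x)]
  have step : ∀ x ∈ Q, ∀ y ∈ Q, ∀ z ∈ Q, x ≠ r → y ≠ r → z ≠ r → x ≠ y → x ≠ z →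
      τ x y = τ x z := by
    intro x hx y hy z hz hxr hyr hzr hxy hxz
    have := h4 r hr y hy x hx z hz hyr.symm hxr.symm hzr.symm hxy.symm hxz
    simp only [hτ, mul_assoc]
    rw [G.sgn_comm r y, G.sgn_comm x y, this, G.sgn_comm r z, G.sgn_comm x z]
  have hconst : ∀ x ∈ Q, ∀ y ∈ Q, x ≠ r → y ≠ r → x ≠ y → τ x y = τ u v := by
    intro x hx y hy hxr hyr hxy
    by_cases hxu : x = u
    · subst hxu
      exact step x hx y hy v hv hxr hyr hrv.symm hxy huv
    · rw [step x hx y hy u hu hxr hyr hru.symm hxy hxu, hcomm,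
        step u hu x hx v hv hru.symm hxr hrv.symm (Ne.symm hxu) huv]
  refine ⟨τ u v, fun x => if x = r then τ u v else G.sgn r x, fun x hx y hy hxy => ?_⟩
  by_cases hxr : x = r
  · subst hxr
    simp only [if_true, if_neg hxy.symm, units_mul_cancel]
  · by_cases hyr : y = r
    · subst hyr
      simp only [if_true, if_neg hxy]
      rw [mul_comm (G.sgn y x), units_mul_cancel, sgn_comm]
    · simp only [if_neg hxr, if_neg hyr]
      rw [← hconst x hx y hy hxr hyr hxy, hτ]
      simp only
      rw [mul_comm, ← mul_assoc, ← sq, Int.units_sq, one_mul]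

lemma walkSign_eq_pow (G : SignedGraph V) {a b : V} (p : G.graph.Walk a b) (A : Finset V)
    (s : ℤˣ) (g : V → ℤˣ)
    (hg : ∀ x ∈ A, ∀ y ∈ A, x ≠ y → G.sgn x y = s * (g x * g y))
    (hp : ∀ x ∈ p.support, x ∈ A) : G.walkSign p = s ^ p.length * (g a * g b) := by
  induction p with
  | nil => simp [← sq]
  | @cons u v w h p ih =>
    simp only [SimpleGraph.Walk.support_cons, List.mem_cons, forall_eq_or_imp] at hp
    rw [walkSign_cons, ih hp.2, hg u hp.1 v (hp.2 v p.start_mem_support) h.ne,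
      SimpleGraph.Walk.length_cons, pow_succ']
    calc s * (g u * g v) * (s ^ p.length * (g v * g w))
        = s * s ^ p.length * (g u * g w) * (g v ^ 2) := by
          rw [sq]; simp only [mul_assoc, mul_comm, mul_left_comm]
      _ = _ := by rw [Int.units_sq, mul_one]

/-- Up to a potential every edge of the clique has the same sign `s`, so a cycle of length `2k + 1`
has sign `s ^ (2k + 1) = s` by oddness, whence `s = 1`. -/
theorem exists_isPotential_of_isClique (G : SignedGraph V) {Q : Finset V} {k : ℕ} (hk : 1 ≤ k)
    (hfree : G.Free (negCycle (2 * k + 1))) (hQ : G.graph.IsClique (Q : Set V))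
    (hcard : 2 * k + 2 ≤ #Q) : ∃ g, G.IsPotential Q g := by
  obtain ⟨s, g, hg⟩ := G.exists_potential_up_to_sign (Q := Q) (by omega)
    (fun a ha b hb c hc d hd hab hac had hbc hcd =>
      G.sgn_mul_sgn_eq_of_isClique (m := 2 * k - 1) (by omega)
        (by rwa [show 2 * k - 1 + 2 = 2 * k + 1 by omega]) hQ (by omega)
        ha hb hc hd hab hac had hbc hcd)
  obtain ⟨a, ha, b, hb, hab⟩ := one_lt_card.1 (show 1 < #Q by omega)
  obtain ⟨p, hp, hl, hs⟩ := G.pathConnected_of_isClique (2 * k) Q hQ (by omega) (by omega)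
    a ha b hb hab
  have h := G.walkSign_mul_sgn_of_free (by omega) hfree p hp hl (hQ hb ha hab.symm)
  rw [G.walkSign_eq_pow p Q s g hg hs, hg b hb a ha hab.symm, hl, pow_mul, Int.units_sq, one_pow,
    one_mul, mul_comm (g b)] at h
  have hs1 : s = 1 := by
    rwa [mul_left_comm, ← sq, Int.units_sq, mul_one] at h
  exact ⟨g, fun x hx y hy hxy => by rw [hg x hx y hy hxy.ne, hs1, one_mul]⟩

/-! ### Counting missing edges, and Turán's theorem -/

lemma sum_card_filter_adj_le (H : SimpleGraph V) [DecidableRel H.Adj] {S T : Finset V}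
    (hST : Disjoint S T) (E : Finset (Sym2 V))
    (hE : ∀ x ∈ S, ∀ y ∈ T, H.Adj x y → s(x, y) ∈ E) :
    ∑ x ∈ S, #{y ∈ T | H.Adj x y} ≤ #E := by
  rw [← card_sigma]
  refine card_le_card_of_injOn (fun p => s(p.1, p.2)) ?_ ?_
  · rintro ⟨x, y⟩ hp
    simp only [coe_sigma, Set.mem_sigma_iff, mem_coe, mem_filter] at hp
    exact hE x hp.1 y hp.2.1 hp.2.2
  · rintro ⟨x, y⟩ hp ⟨x', y'⟩ hp' h
    simp only [coe_sigma, Set.mem_sigma_iff, mem_coe, mem_filter] at hp hp'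
    rcases Sym2.eq_iff.1 h with ⟨rfl, rfl⟩ | ⟨rfl, rfl⟩
    · rfl
    · exact absurd hp'.2.1 (disjoint_left.1 hST hp.1)

lemma card_filter_compl_adj (G : SimpleGraph V) [DecidableRel G.Adj] [DecidableRel Gᶜ.Adj]
    {A : Finset V} {v : V} (hv : v ∉ A) :
    #{y ∈ A | Gᶜ.Adj v y} + #{y ∈ A | G.Adj v y} = #A := by
  have h : {y ∈ A | Gᶜ.Adj v y} = {y ∈ A | ¬ G.Adj v y} := by
    refine filter_congr fun y hy => ?_
    rw [SimpleGraph.compl_adj, and_iff_right]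
    rintro rfl
    exact hv hy
  rw [h, add_comm]
  exact card_filter_add_card_filter_not _

lemma card_edgeFinset_compl [Fintype V] [DecidableEq V] (G : SimpleGraph V)
    [DecidableRel G.Adj] : 2 * #G.edgeFinset + 2 * #Gᶜ.edgeFinset =
      Fintype.card V * (Fintype.card V - 1) := by
  rw [← G.sum_degrees_eq_twice_card_edges, ← Gᶜ.sum_degrees_eq_twice_card_edges,
    ← sum_add_distrib, sum_congr rfl fun v _ => ?_, sum_const, smul_eq_mul, card_univ]
  rw [G.degree_compl]
  have := G.degree_lt_card_verts v
  omega

lemma exists_isNClique_of_card_edgeFinset_compl_le [Fintype V] [DecidableEq V] (G : SimpleGraph V)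
    [DecidableRel G.Adj] {k : ℕ} (hk : 10 * k + 10 ≤ Fintype.card V)
    (hG : #Gᶜ.edgeFinset + 6 ≤ 2 * Fintype.card V) :
    ∃ Q : Finset V, G.IsNClique (2 * k + 2) Q := by
  by_contra! hQ
  have h1 : G.CliqueFree ((2 * k + 1) + 1) := fun Q => hQ Q
  have h2 := h1.card_edgeFinset_le
  simp only at h2
  rw [← SimpleGraph.card_edgeFinset_turanGraph] at h2
  have h3 := SimpleGraph.mul_card_edgeFinset_turanGraph_le (n := Fintype.card V) (r := 2 * k + 1)
  have h4 : 2 * (2 * k + 1) * #G.edgeFinset ≤ 2 * k * Fintype.card V ^ 2 :=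
    (Nat.mul_le_mul_left _ h2).trans h3
  have h5 := card_edgeFinset_compl G
  generalize #G.edgeFinset = e at *
  generalize #Gᶜ.edgeFinset = m at *
  obtain ⟨n, hn⟩ : ∃ n, Fintype.card V = n + 1 := ⟨Fintype.card V - 1, by omega⟩
  rw [hn] at h4 h5 hG hk
  rw [Nat.add_sub_cancel] at h5
  have h6 : (n + 1) * n + 12 ≤ 2 * e + 4 * (n + 1) := by omega
  -- With `N = n + 1` vertices this reads `N ^ 2 + 12 * (2k + 1) ≤ 5 * (2k + 1) * N`, impossible
  -- once `N ≥ 10k + 10`.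
  have h7 : (2 * k + 1) * ((n + 1) * n + 12) ≤ 2 * k * (n + 1) ^ 2 + (2 * k + 1) * (4 * (n + 1)) := by
    nlinarith
  nlinarith

/-! ### Two vertices outside a set with a potential -/

lemma balanced_of_pair (G : SignedGraph V) {A : Finset V} {g : V → ℤˣ} {u v : V}
    (hV : ∀ x, x ∈ A ∨ x = u ∨ x = v) (hA : G.IsPotential A g)
    (hu : ∀ a ∈ A, G.graph.Adj u a → G.sgn u a = g u * g a)
    (hv : ∀ a ∈ A, G.graph.Adj v a → G.sgn v a = g v * g a)
    (huv : G.graph.Adj u v → G.sgn u v = g u * g v) : G.Balanced := by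
  refine G.balanced_of_potential g fun x y hxy => ?_
  rcases hV x with hx | rfl | rfl <;> rcases hV y with hy | rfl | rfl
  · exact hA x hx y hy hxy
  · rw [sgn_comm, hu x hx hxy.symm, mul_comm]
  · rw [sgn_comm, hv x hx hxy.symm, mul_comm]
  · exact hu y hy hxy
  · exact absurd rfl hxy.ne
  · exact huv hxy
  · exact hv y hy hxy
  · rw [sgn_comm, huv hxy.symm, mul_comm]
  · exact absurd rfl hxy.ne

/-- Only `v` can be adjacent to `u`, so the value at `u` is free to be reset to suit that one edge.
-/
lemma balanced_of_no_neighbor (G : SignedGraph V) {A : Finset V} {g : V → ℤˣ} {u v : V}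
    (hu' : u ∉ A) (hne : u ≠ v)
    (hV : ∀ x, x ∈ A ∨ x = u ∨ x = v) (hA : G.IsPotential A g)
    (hu : ∀ a ∈ A, ¬ G.graph.Adj u a)
    (hv : ∀ a ∈ A, G.graph.Adj v a → G.sgn v a = g v * g a) : G.Balanced := by
  classical
  have hgA : ∀ x ∈ A, Function.update g u (G.sgn u v * g v) x = g x := by
    intro x hx
    rw [Function.update_of_ne]
    rintro rfl
    exact hu' hx
  have hgv : Function.update g u (G.sgn u v * g v) v = g v :=
    Function.update_of_ne hne.symm _ _
  refine G.balanced_of_pair (g := Function.update g u (G.sgn u v * g v)) hV ?_ ?_ ?_ ?_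
  · intro x hx y hy hxy
    rw [hgA x hx, hgA y hy, hA x hx y hy hxy]
  · exact fun a ha h => absurd h (hu a ha)
  · intro a ha h
    rw [hgv, hgA a ha, hv a ha h]
  · intro _
    rw [hgv, Function.update_self, mul_assoc, ← sq, Int.units_sq, mul_one]

/-- A negative triangle on `u, v, w` attached at `w` to a clique `A` without negative cycles,
where `u`, `v` and `A` exhaust the vertices. -/
structure IsTriangleCoalescence (G : SignedGraph V) (A : Finset V) (u v w : V) (g : V → ℤˣ) :
    Prop where
  ne : u ≠ v
  u_notMem : u ∉ A
  v_notMem : v ∉ A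
  w_mem : w ∈ A
  exhaust : ∀ x, x ∈ A ∨ x = u ∨ x = v
  clique : G.graph.IsClique (A : Set V)
  potential : G.IsPotential A g
  adj_uv : G.graph.Adj u v
  adj_u : ∀ x ∈ A, G.graph.Adj u x ↔ x = w
  adj_v : ∀ x ∈ A, G.graph.Adj v x ↔ x = w
  sgn_uw : G.sgn u w = g u * g w
  sgn_vw : G.sgn v w = g v * g w
  sgn_uv : G.sgn u v = -(g u * g v)

lemma isTriangleCoalescence_of_pair [Fintype V] [DecidableEq V] (G : SignedGraph V)
    [DecidableRel G.graph.Adj]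
    {A : Finset V} {g : V → ℤˣ} {k : ℕ} {u v : V} (hk : 2 ≤ k)
    (hunbalanced : ¬ G.Balanced) (hfree : G.Free (negCycle (2 * k + 1)))
    (hg : G.IsPotential A g) (h0 : G.PathConnected A (2 * k - 2))
    (h1 : G.PathConnected A (2 * k - 1)) (hne : u ≠ v) (hu : u ∉ G.absorb A)
    (hv : v ∉ G.absorb A) (hV : ∀ x, x ∈ A ∨ x = u ∨ x = v)
    (hG : #G.graphᶜ.edgeFinset + 6 ≤ 2 * Fintype.card V) :
    ∃ w g', G.IsTriangleCoalescence A u v w g' := by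
  have huA : u ∉ A := fun h => hu (G.subset_absorb A h)
  have hvA : v ∉ A := fun h => hv (G.subset_absorb A h)
  obtain ⟨g', hgA, hgv⟩ := G.exists_extend_potential (m := 2 * k - 1) (by omega)
    (by rwa [show 2 * k - 1 + 2 = 2 * k + 1 by omega]) hg h1
  have hg' : G.IsPotential A g' := by
    intro x hx y hy hxy
    rw [hgA x hx, hgA y hy, hg x hx y hy hxy]
  have key : ∀ x ∉ A, ∀ y ∈ A, G.graph.Adj x y → G.sgn x y = g' x * g' y := by
    intro x hx y hy hxy
    rw [hgv x hx y hy hxy, hgA y hy, mul_assoc, ← sq, Int.units_sq, mul_one]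
  have hV' : ∀ x, x ∈ A ∨ x = v ∨ x = u := fun x => (hV x).imp_right Or.symm
  obtain ⟨a, ha, hua⟩ : ∃ a ∈ A, G.graph.Adj u a := by
    by_contra! h
    exact hunbalanced (G.balanced_of_no_neighbor huA hne hV hg' h (key v hvA))
  obtain ⟨b, hb, hvb⟩ : ∃ b ∈ A, G.graph.Adj v b := by
    by_contra! h
    exact hunbalanced (G.balanced_of_no_neighbor hvA hne.symm hV' hg' h (key u huA))
  obtain ⟨huv, hs⟩ : G.graph.Adj u v ∧ G.sgn u v ≠ g' u * g' v := by
    by_contra! h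
    exact hunbalanced (G.balanced_of_pair hV hg' (key u huA) (key v hvA) h)
  -- Distinct attachment points would give a cycle of length `2k + 1` through `uv`, forcing that
  -- edge to obey the potential.
  obtain rfl : a = b := by
    by_contra hab
    refine hs ?_
    rw [hgv u huA a ha hua, hgv v hvA b hb hvb]
    exact G.sgn_eq_of_pathConnected (m := 2 * k - 2)
      (by rwa [show 2 * k - 2 + 3 = 2 * k + 1 by omega]) hg h0 huA hvA ha hb huv hua hvb hab
  have adj_u : ∀ x ∈ A, G.graph.Adj u x ↔ x = a := fun x hx =>
    ⟨fun h => G.eq_of_notMem_absorb hu hx ha h hua, fun h => h ▸ hua⟩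
  have adj_v : ∀ x ∈ A, G.graph.Adj v x ↔ x = a := fun x hx =>
    ⟨fun h => G.eq_of_notMem_absorb hv hx ha h hvb, fun h => h ▸ hvb⟩
  refine ⟨a, g', hne, huA, hvA, ha, hV, ?_, hg', huv, adj_u, adj_v, key u huA a ha hua,
    key v hvA a ha hvb, ?_⟩
  -- The vertices `u, v` already miss `2 * (#A - 1) = 2n - 6` pairs into `A`, the whole budget; a
  -- non-edge inside `A` would exceed it.
  · intro x hx y hy hxy
    by_contra hadj
    have hdisj : Disjoint ({u, v} : Finset V) A := by
      rw [disjoint_left]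
      intro z hz hzA
      simp only [mem_insert, mem_singleton] at hz
      rcases hz with rfl | rfl
      exacts [huA hzA, hvA hzA]
    have hcount := sum_card_filter_adj_le G.graphᶜ hdisj (G.graphᶜ.edgeFinset.erase s(x, y)) (by
      intro z hz y' hy' hzy
      rw [mem_erase, SimpleGraph.mem_edgeFinset]
      refine ⟨fun h => ?_, hzy⟩
      rcases Sym2.eq_iff.1 h with ⟨rfl, rfl⟩ | ⟨rfl, rfl⟩
      exacts [disjoint_left.1 hdisj hz hx, disjoint_left.1 hdisj hz hy])
    have hmem : s(x, y) ∈ G.graphᶜ.edgeFinset := by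
      rw [SimpleGraph.mem_edgeFinset, SimpleGraph.mem_edgeSet, SimpleGraph.compl_adj]
      exact ⟨hxy, hadj⟩
    rw [card_erase_of_mem hmem, sum_pair hne] at hcount
    have hpos := card_pos.2 ⟨_, hmem⟩
    have hA : #A + 2 = Fintype.card V := by
      rw [← card_univ, ← card_pair hne, add_comm, ← card_union_of_disjoint hdisj]
      congr 1
      ext z
      simpa [or_comm, or_assoc] using hV' z
    have e1 := card_filter_compl_adj G.graph huA
    have e2 := card_filter_compl_adj G.graph hvA
    have e3 : #{y ∈ A | G.graph.Adj u y} = 1 := by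
      rw [filter_congr adj_u, filter_eq', if_pos ha, card_singleton]
    have e4 : #{y ∈ A | G.graph.Adj v y} = 1 := by
      rw [filter_congr adj_v, filter_eq', if_pos ha, card_singleton]
    omega
  · rcases Int.units_eq_one_or (G.sgn u v) with h | h <;>
      rcases Int.units_eq_one_or (g' u * g' v) with h' | h' <;> simp_all

theorem exists_isTriangleCoalescence [Fintype V] [DecidableEq V] (G : SignedGraph V)
    [DecidableRel G.graph.Adj] {k : ℕ} (hk : 3 ≤ k) (hkn : 10 * k + 10 ≤ Fintype.card V)
    (hunbalanced : ¬ G.Balanced) (hfree : G.Free (negCycle (2 * k + 1)))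
    (hG : #G.graphᶜ.edgeFinset + 6 ≤ 2 * Fintype.card V) :
    ∃ A u v w g, G.IsTriangleCoalescence A u v w g := by
  obtain ⟨Q, hQ, hcard⟩ := exists_isNClique_of_card_edgeFinset_compl_le G.graph hkn hG
  obtain ⟨g₀, hg₀⟩ := G.exists_isPotential_of_isClique (by omega) hfree hQ hcard.ge
  have hfree' : G.Free (negCycle (2 * k - 2 + 3)) := by
    rwa [show 2 * k - 2 + 3 = 2 * k + 1 by omega]
  have conn₀ : ∀ l, 1 ≤ l → l ≤ 2 * k + 1 → G.PathConnected Q l := fun l hl hl' =>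
    G.pathConnected_of_isClique l Q hQ hl (by omega)
  have conn₁ : ∀ l, 3 ≤ l → l ≤ 2 * k + 1 → G.PathConnected (G.absorb Q) l := by
    intro l hl hl'
    obtain ⟨l, rfl⟩ : ∃ j, l = j + 2 := ⟨l - 2, by omega⟩
    exact G.pathConnected_absorb (conn₀ _ (by omega) (by omega)) (conn₀ _ (by omega) (by omega))
      (conn₀ _ (by omega) (by omega))
  -- Length `2k - 1` is the one needed in the second absorption, and `2k - 1 ≥ 5` is exactly `k ≥
  -- 3`.
  have conn₂ : ∀ l, 5 ≤ l → l ≤ 2 * k + 1 → G.PathConnected (G.absorb (G.absorb Q)) l := by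
    intro l hl hl'
    obtain ⟨l, rfl⟩ : ∃ j, l = j + 2 := ⟨l - 2, by omega⟩
    exact G.pathConnected_absorb (conn₁ _ (by omega) (by omega)) (conn₁ _ (by omega) (by omega))
      (conn₁ _ (by omega) (by omega))
  obtain ⟨g₁, hg₁⟩ := G.exists_isPotential_absorb hfree' hg₀
    (conn₀ _ (by omega) (by omega)) (conn₀ _ (by omega) (by omega))
  obtain ⟨g₂, hg₂⟩ := G.exists_isPotential_absorb hfree' hg₁
    (conn₁ _ (by omega) (by omega)) (conn₁ _ (by omega) (by omega))
  have hsub₁ := G.subset_absorb Q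
  have hsub₂ := G.subset_absorb (G.absorb Q)
  set A := G.absorb Q with hA
  set B := G.absorb A with hB
  obtain ⟨u, v, hu, hv, huv⟩ : ∃ u v, u ∉ B ∧ v ∉ B ∧ u ≠ v := by
    by_contra! h
    obtain ⟨g', hgA, hgv⟩ := G.exists_extend_potential (m := 2 * k - 1) (by omega)
      (by rwa [show 2 * k - 1 + 2 = 2 * k + 1 by omega]) hg₂ (conn₂ _ (by omega) (by omega))
    have key : ∀ x ∉ B, ∀ y ∈ B, G.graph.Adj x y → G.sgn x y = g' x * g' y := by
      intro x hx y hy hxy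
      rw [hgv x hx y hy hxy, hgA y hy, mul_assoc, ← sq, Int.units_sq, mul_one]
    refine hunbalanced (G.balanced_of_potential g' fun x y hxy => ?_)
    by_cases hx : x ∈ B <;> by_cases hy : y ∈ B
    · rw [hgA x hx, hgA y hy, hg₂ x hx y hy hxy]
    · rw [sgn_comm, key y hy x hx hxy.symm, mul_comm]
    · exact key x hx y hy hxy
    · exact absurd (h x y hx hy) hxy.ne
  have huA : u ∉ A := fun h => hu (hsub₂ h)
  have hvA : v ∉ A := fun h => hv (hsub₂ h)
  have hV : ∀ x, x ∈ A ∨ x = u ∨ x = v := by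
    have hcount := sum_card_filter_adj_le G.graphᶜ (disjoint_compl_left (a := A))
      G.graphᶜ.edgeFinset (fun x _ y _ h => SimpleGraph.mem_edgeFinset.2 h)
    have hfew : ∀ (x : V) (C : Finset V), x ∉ G.absorb C →
        #C ≤ #{y ∈ C | G.graphᶜ.Adj x y} + 1 := by
      intro x C hx
      have e1 := card_filter_compl_adj G.graph (fun h => hx (G.subset_absorb C h))
      have e2 : #{y ∈ C | G.graph.Adj x y} ≤ 1 := by
        rw [card_le_one]
        intro a ha b hb
        simp only [mem_filter] at ha hb
        exact G.eq_of_notMem_absorb hx ha.1 hb.1 ha.2 hb.2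
      omega
    have hbig : ∀ x ∈ (Aᶜ.erase u).erase v, 2 * k + 1 ≤ #{y ∈ A | G.graphᶜ.Adj x y} := by
      intro x hx
      have hxA : x ∉ A := by simpa using mem_of_mem_erase (mem_of_mem_erase hx)
      have := hfew x Q hxA
      have h2 : #{y ∈ Q | G.graphᶜ.Adj x y} ≤ #{y ∈ A | G.graphᶜ.Adj x y} :=
        card_le_card (filter_subset_filter _ hsub₁)
      omega
    have hu' : u ∈ Aᶜ := by simpa using huA
    have hv' : v ∈ Aᶜ.erase u := by simpa [huv.symm] using hvA
    have hsum := card_nsmul_le_sum _ _ _ hbig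
    rw [← add_sum_erase _ _ hu', ← add_sum_erase _ _ hv'] at hcount
    have c1 := card_erase_add_one hu'
    have c2 := card_erase_add_one hv'
    have c3 := card_add_card_compl A
    have c4 := hfew u A hu
    have c5 := hfew v A hv
    rw [smul_eq_mul] at hsum
    have h7 := Nat.mul_le_mul_left (#((Aᶜ.erase u).erase v)) (show 7 ≤ 2 * k + 1 by omega)
    -- With `t` vertices besides `u, v` outside `A`, the count is `2 * (#A - 1) + 7 * t ≤ 2 * (#A +
    -- t + 2) - 6`, so `5 * t ≤ 0`.
    have hzero : #((Aᶜ.erase u).erase v) = 0 := by omega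
    intro x
    by_contra! hx
    rw [card_eq_zero] at hzero
    have : x ∈ (Aᶜ.erase u).erase v := by simp [hx]
    simp [hzero] at this
  obtain ⟨w, g', h⟩ := G.isTriangleCoalescence_of_pair (by omega) hunbalanced hfree hg₁
    (conn₁ _ (by omega) (by omega)) (conn₁ _ (by omega) (by omega)) huv hu hv hV hG
  exact ⟨A, u, v, w, g', h⟩

/-! ### The extremal graph -/

lemma negTriangleCoalescence_adj {n : ℕ} {i j : Fin n} :
    (negTriangleCoalescence n).graph.Adj i j ↔
      i ≠ j ∧ ((i.val ≤ 2 ∧ j.val ≤ 2) ∨ (2 ≤ i.val ∧ 2 ≤ j.val)) := Iff.rfl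

lemma negTriangleCoalescence_sgn {n : ℕ} {i j : Fin n} (hi : i.val = 0) (hj : j.val = 1) :
    (negTriangleCoalescence n).sgn i j = -1 := by
  have hadj : (negTriangleCoalescence n).graph.Adj i j := by
    rw [negTriangleCoalescence_adj, ne_eq, Fin.ext_iff]
    omega
  rw [sgn_of_adj _ hadj]
  change (if _ then _ else _ : ℤˣ) = -1
  rw [if_pos]
  exact ⟨i, j, hi, hj, rfl⟩

lemma negTriangleCoalescence_sgn_of_two_le {n : ℕ} {i j : Fin n} (hj : 2 ≤ j.val) :
    (negTriangleCoalescence n).sgn i j = 1 := by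
  by_cases hadj : (negTriangleCoalescence n).graph.Adj i j
  · rw [sgn_of_adj _ hadj]
    change (if _ then _ else _ : ℤˣ) = 1
    rw [if_neg]
    rintro ⟨a, b, ha, hb, hs⟩
    rcases Sym2.eq_iff.1 hs with ⟨rfl, rfl⟩ | ⟨rfl, rfl⟩ <;> omega
  · rw [sgn, dif_neg hadj]

/-- The clique on `m + 1` vertices contributes `(m + 1) * m` to the degree sum and the triangle,
which shares no edge with it, contributes `6`. -/
lemma edgeCount_negTriangleCoalescence (m : ℕ) :
    2 * (negTriangleCoalescence (m + 3)).edgeCount = m ^ 2 + m + 6 := by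
  classical
  have h : (negTriangleCoalescence (m + 3)).edgeCount =
      #(negTriangleCoalescence (m + 3)).graph.edgeFinset := by
    rw [edgeCount, ← SimpleGraph.coe_edgeFinset, Set.ncard_coe_finset]
  rw [h, ← SimpleGraph.sum_degrees_eq_twice_card_edges]
  have hdeg : ∀ i, (negTriangleCoalescence (m + 3)).graph.degree i =
      ∑ j, if i ≠ j ∧ ((i.val ≤ 2 ∧ j.val ≤ 2) ∨ (2 ≤ i.val ∧ 2 ≤ j.val)) then 1 else 0 := by
    intro i
    rw [← SimpleGraph.card_neighborFinset_eq_degree, SimpleGraph.neighborFinset_eq_filter,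
      card_filter]
    exact sum_congr rfl fun j _ => by simp only [negTriangleCoalescence_adj]
  have hrow : ∀ i : Fin m, ∑ j : Fin m, (if i.val = j.val then 0 else 1) = m - 1 := by
    intro i
    have : ∀ j : Fin m, (if i.val = j.val then 0 else 1) = if j ≠ i then 1 else 0 := fun j => by
      simp only [Fin.val_inj]
      by_cases h : i = j <;> simp [h, eq_comm]
    rw [sum_congr rfl fun j _ => this j, ← card_filter, filter_ne', card_erase_of_mem (mem_univ _),
      card_univ, Fintype.card_fin]
  have h3 : ∀ j : Fin m, j.val + 1 + 1 + 1 = j.val + 3 := fun j => rfl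
  have hle : ∀ j : Fin m, ¬ j.val + 3 ≤ 2 := fun j => by omega
  have hne : ∀ j : Fin m, ¬ j.val + 3 = 2 := fun j => by omega
  simp only [hdeg, Fin.sum_univ_succ, ne_eq, Fin.ext_iff, Fin.val_succ, Fin.val_zero, h3]
  norm_num [hle, hne, hrow]
  cases m with
  | zero => rfl
  | succ m =>
    rw [Nat.add_sub_cancel]
    ring

open Classical in
theorem IsTriangleCoalescence.switchEquiv [Fintype V] {G : SignedGraph V} {A : Finset V}
    {u v w : V} {g : V → ℤˣ} (h : G.IsTriangleCoalescence A u v w g) :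
    G.SwitchEquiv (negTriangleCoalescence (Fintype.card V)) := by
  have huw : u ≠ w := fun e => h.u_notMem (e ▸ h.w_mem)
  have hvw : v ≠ w := fun e => h.v_notMem (e ▸ h.w_mem)
  have huv := h.ne
  have hcard : 3 ≤ Fintype.card V := by
    rw [← card_eq_three.2 ⟨u, v, w, huv, huw, hvw, rfl⟩]
    exact card_le_univ _
  generalize hn : Fintype.card V = n at hcard
  let f : Fin n → V := fun i => if i.val = 0 then u else if i.val = 1 then v else w
  -- Only the labels `0, 1, 2` of `u, v, w` matter; the other vertices of the clique are
  -- interchangeable.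
  obtain ⟨φ, hφ⟩ : ∃ φ : Fin n ≃ V, ∀ i : Fin n, i.val ≤ 2 → φ i = f i := by
    obtain ⟨e, he⟩ := exists_equiv_extend_of_card_eq (t := (univ : Finset V))
      (s := ({i | i.val ≤ 2} : Finset (Fin n))) (f := f) (by rw [Fintype.card_fin, card_univ, hn])
      (subset_univ _) (by
        intro i hi j hj hij
        simp only [coe_filter, mem_univ, true_and, Set.mem_ofPred_eq] at hi hj
        simp only [f] at hij
        refine Fin.ext ?_
        split_ifs at hij <;> first | omega | (exfalso; simp_all))
    exact ⟨e.trans (Equiv.subtypeUnivEquiv fun x => mem_univ x), fun i hi => he i (by simpa using hi)⟩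
  have h0 : ∀ i : Fin n, i.val = 0 → φ i = u := fun i hi => by
    rw [hφ i (by omega)]; simp [f, hi]
  have h1 : ∀ i : Fin n, i.val = 1 → φ i = v := fun i hi => by
    rw [hφ i (by omega)]; simp [f, hi]
  have h2 : ∀ i : Fin n, i.val = 2 → φ i = w := fun i hi => by
    rw [hφ i (by omega)]; simp [f, hi]
  have hA : ∀ i : Fin n, 2 ≤ i.val → φ i ∈ A := by
    intro i hi
    rcases h.exhaust (φ i) with hx | hx | hx
    · exact hx
    · rw [← h0 ⟨0, by omega⟩ rfl] at hx
      have := Fin.ext_iff.1 (φ.injective hx)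
      simp at this
      omega
    · rw [← h1 ⟨1, by omega⟩ rfl] at hx
      have := Fin.ext_iff.1 (φ.injective hx)
      simp at this
      omega
  have hw : ∀ i : Fin n, φ i = w → i.val = 2 := by
    intro i hi
    rw [← h2 ⟨2, by omega⟩ rfl] at hi
    exact Fin.ext_iff.1 (φ.injective hi)
  have key : ∀ i j : Fin n, i.val ≤ j.val →
      ((G.graph.Adj (φ i) (φ j) ↔ (negTriangleCoalescence n).graph.Adj i j) ∧
        ((negTriangleCoalescence n).graph.Adj i j → G.sgn (φ i) (φ j) =
          g (φ i) * g (φ j) * (negTriangleCoalescence n).sgn i j)) := by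
    intro i j hij
    rw [negTriangleCoalescence_adj]
    by_cases hne : i = j
    · subst hne
      simp
    have hne' : i.val ≠ j.val := fun e => hne (Fin.ext e)
    by_cases hj : 2 ≤ j.val
    · rw [negTriangleCoalescence_sgn_of_two_le hj, mul_one]
      have hjA := hA j hj
      by_cases hi : 2 ≤ i.val
      · have hadj : G.graph.Adj (φ i) (φ j) :=
          h.clique (hA i hi) hjA (fun e => hne (φ.injective e))
        exact ⟨iff_of_true hadj ⟨hne, by omega⟩, fun _ => h.potential _ (hA i hi) _ hjA hadj⟩
      · have hj2 : φ j = w ↔ j.val = 2 := ⟨hw j, h2 j⟩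
        rcases (by omega : i.val = 0 ∨ i.val = 1) with hi0 | hi1
        · rw [h0 i hi0, h.adj_u _ hjA, hj2]
          refine ⟨⟨fun e => ⟨hne, by omega⟩, fun e => by omega⟩, fun e => ?_⟩
          rw [h2 j (by omega), h.sgn_uw]
        · rw [h1 i hi1, h.adj_v _ hjA, hj2]
          refine ⟨⟨fun e => ⟨hne, by omega⟩, fun e => by omega⟩, fun e => ?_⟩
          rw [h2 j (by omega), h.sgn_vw]
    · have hi0 : i.val = 0 := by omega
      have hj1 : j.val = 1 := by omega
      rw [h0 i hi0, h1 j hj1, negTriangleCoalescence_sgn hi0 hj1, h.sgn_uv, mul_neg_one]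
      exact ⟨iff_of_true h.adj_uv ⟨hne, by omega⟩, fun _ => rfl⟩
  refine G.switchEquiv_of_potential _ ⟨φ, fun {i j} => ?_⟩ g fun i j hij => ?_
  · rcases le_total i.val j.val with hij | hij
    · exact (key i j hij).1
    · rw [SimpleGraph.adj_comm, (key j i hij).1, SimpleGraph.adj_comm]
  · change G.sgn (φ i) (φ j) = g (φ i) * g (φ j) * _
    rcases le_total i.val j.val with hle | hle
    · exact (key i j hle).2 hij
    · rw [sgn_comm, (key j i hle).2 hij.symm, sgn_comm _ j i, mul_comm (g _)]

/-! ### The bound and the equality case -/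

/-- The edge bound for unbalanced `C_{2k+1}^-`-free signed graphs and its equality case. -/
theorem edgeCount_le_and_eq_iff [Fintype V] (G : SignedGraph V) (n k : ℕ)
    (hn : Fintype.card V = n) (hk : 3 ≤ k) (hkn : (k : ℝ) ≤ (n : ℝ) / 10 - 1)
    (hunbalanced : ¬ G.Balanced) (hfree : G.Free (negCycle (2 * k + 1))) :
    (G.edgeCount : ℝ) ≤ (n : ℝ) * ((n : ℝ) - 1) / 2 - 2 * ((n : ℝ) - 3) ∧
      ((G.edgeCount : ℝ) = (n : ℝ) * ((n : ℝ) - 1) / 2 - 2 * ((n : ℝ) - 3) ↔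
        G.SwitchEquiv (negTriangleCoalescence n)) := by
  classical
  subst hn
  have hkn' : 10 * k + 10 ≤ Fintype.card V := by
    have : (10 * k + 10 : ℝ) ≤ Fintype.card V := by linarith
    exact_mod_cast this
  have hedge : G.edgeCount = G.graph.edgeFinset.card := by
    rw [edgeCount, ← SimpleGraph.coe_edgeFinset, Set.ncard_coe_finset]
  have hcompl := card_edgeFinset_compl G.graph
  have hexact : G.SwitchEquiv (negTriangleCoalescence (Fintype.card V)) →
      (G.edgeCount : ℝ) = (Fintype.card V : ℝ) * ((Fintype.card V : ℝ) - 1) / 2 -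
        2 * ((Fintype.card V : ℝ) - 3) := by
    intro h
    rw [edgeCount_eq_of_switchEquiv h]
    obtain ⟨m, hm⟩ : ∃ m, Fintype.card V = m + 3 := ⟨Fintype.card V - 3, by omega⟩
    rw [hm]
    have h2 : (2 * (negTriangleCoalescence (m + 3)).edgeCount : ℝ) = m ^ 2 + m + 6 := by
      exact_mod_cast edgeCount_negTriangleCoalescence m
    push_cast
    linarith
  -- Assuming only `≥` serves twice: a graph above the bound would be the extremal one, whose edge
  -- count equals the bound.
  have hextremal : (Fintype.card V : ℝ) * ((Fintype.card V : ℝ) - 1) / 2 -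
      2 * ((Fintype.card V : ℝ) - 3) ≤ G.edgeCount →
      G.SwitchEquiv (negTriangleCoalescence (Fintype.card V)) := by
    intro h
    have hmiss : G.graphᶜ.edgeFinset.card + 6 ≤ 2 * Fintype.card V := by
      have hc : (2 * (G.graph.edgeFinset.card : ℝ) + 2 * (G.graphᶜ.edgeFinset.card : ℝ)) =
          Fintype.card V * (Fintype.card V - 1) := by
        rw [← Nat.cast_pred (by omega)]
        exact_mod_cast hcompl
      rw [hedge] at h
      have : (G.graphᶜ.edgeFinset.card + 6 : ℝ) ≤ 2 * Fintype.card V := by linarith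
      exact_mod_cast this
    obtain ⟨A, u, v, w, g, hG⟩ := G.exists_isTriangleCoalescence hk hkn' hunbalanced hfree hmiss
    exact hG.switchEquiv
  refine ⟨?_, fun h => hextremal h.ge, hexact⟩
  by_contra hlt
  exact absurd (hexact (hextremal (not_le.1 hlt).le)).le hlt

end SignedGraph

theorem theorem1 {V : Type*} [Fintype V] (G : SignedGraph V) (n k : ℕ)
    (hn : Fintype.card V = n) (hk : 3 ≤ k) (hkn : (k : ℝ) ≤ (n : ℝ) / 10 - 1)
    (hunbalanced : ¬ G.Balanced) (hfree : G.Free (SignedGraph.negCycle (2 * k + 1))) :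
    (G.edgeCount : ℝ) ≤ (n : ℝ) * ((n : ℝ) - 1) / 2 - 2 * ((n : ℝ) - 3) ∧
      ((G.edgeCount : ℝ) = (n : ℝ) * ((n : ℝ) - 1) / 2 - 2 * ((n : ℝ) - 3) ↔
        G.SwitchEquiv (SignedGraph.negTriangleCoalescence n)) :=
  G.edgeCount_le_and_eq_iff n k hn hk hkn hunbalanced hfree
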